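/- Let $\mathbb C_\theta=\{s\in\mathbb C:\operatorname{Re}s>\theta\}$ and let $\mathcal H$ be the Hilbert space of Dirichlet series $f(s)=\sum_{n\ge1}a_nn^{-s}$ with $\|f\|=\big(\sum_{n\ge 1}|a_n|^2\big)^{1/2}<\infty$; these are analytic functions on $\mathbb C_{1/2}$. The Gordon--Hedenmalm class $\mathcal G$ consists of the maps $\varphi:\mathbb C_{1/2}\to\mathbb C_{1/2}$ of the form $\varphi(s)=c_0s+\psi(s)$, where $c_0$ is a non-negative integer (the characteristic of $\varphi$) and $\psi(s)=\sum_{n\ge1}c_nn^{-s}$ converges uniformly in $\mathbb C_\varepsilon$ for every $\varepsilon>0$ and satisfies: (a) if $c_0=0$, then $\psi(\mathbb C_0)\subseteq\mathbb C_{1/2}$; (b) if $c_0\ge1$, then either $\psi\equiv c_1$ with $\operatorname{Re}c_1\ge0$, or $\psi(\mathbb C_0)\subseteq\mathbb C_0$. For $\varphi\in\mathcal G$ let $C_\varphi f=f\circ\varphi$ be the composition operator on $\mathcal H$ with symbol $\varphi$. Theorem. For every integer $c_0\ge0$, the set $$\{C_\varphi:\ \varphi\in\mathcal G \text{ has characteristic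 } c_0 \text{ and } C_\varphi \text{ is a compact operator on } \mathcal H\}$$ is arcwise connected in the operator norm topology: it is non-empty, and any two of its elements are joined by an operator-norm continuous path that stays in the set. -/

import Mathlib

open scoped ENNReal

/-- The open half-plane of complex numbers with real part greater than `θ`. -/
def halfPlane (θ : ℝ) : Set ℂ := {s | θ < s.re}

/-- The Hilbert space of Dirichlet series with square summable coefficients,
`f(s) = ∑ aₙ n^{-s}` with `‖f‖² = ∑ |aₙ|²`; an element is recorded by its coefficient
sequence `(aₙ)`, `n ≥ 1`. The function it represents is `DirichletHilbert.eval`. -/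
abbrev DirichletHilbert : Type := lp (fun _ : ℕ+ => ℂ) 2

namespace DirichletHilbert

/-- The value `f(s) = ∑ aₙ n^{-s}`, meaningful (absolutely convergent) for `Re s > 1/2`. -/
noncomputable def eval (f : DirichletHilbert) (s : ℂ) : ℂ :=
  ∑' n : ℕ+, f n * ((n : ℕ) : ℂ) ^ (-s)

/-- The series defining `eval f s` converges absolutely on `Re s > 1/2`. -/
theorem summable_eval (f : DirichletHilbert) {s : ℂ} (hs : s ∈ halfPlane (1 / 2)) :
    Summable fun n : ℕ+ => f n * ((n : ℕ) : ℂ) ^ (-s) := by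
  have hs' : (1 / 2 : ℝ) < s.re := hs
  have h1 : Summable fun n : ℕ+ => ‖f n‖ ^ 2 := by
    have h := (lp.memℓp f).summable (by norm_num)
    simpa using h
  have h2 : Summable fun n : ℕ+ => ((n : ℕ) : ℝ) ^ (-(2 * s.re)) :=
    (Real.summable_nat_rpow.2 (by linarith)).comp_injective PNat.coe_injective
  refine Summable.of_norm_bounded (h1.add h2) fun n => ?_
  have hn : (0 : ℝ) < ((n : ℕ) : ℝ) := by exact_mod_cast n.pos
  have h3 : ((n : ℕ) : ℝ) ^ (-(2 * s.re)) = (((n : ℕ) : ℝ) ^ (-s.re)) ^ 2 := by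
    rw [← Real.rpow_natCast, ← Real.rpow_mul hn.le]
    congr 1
    push_cast
    ring
  rw [norm_mul, Complex.norm_natCast_cpow_of_pos n.pos, Complex.neg_re, h3]
  nlinarith [sq_nonneg (‖f n‖ - ((n : ℕ) : ℝ) ^ (-s.re)), sq_nonneg ‖f n‖,
    sq_nonneg (((n : ℕ) : ℝ) ^ (-s.re))]

end DirichletHilbert

/-- `φ` belongs to the Gordon-Hedenmalm class and has characteristic `c₀`: it maps the half-plane
`Re s > 1/2` into itself and there equals `c₀ s + ψ(s)`, where the Dirichlet series
`ψ(s) = ∑_{n ≥ 1} cₙ n^{-s}` converges uniformly on `Re s > ε` for every `ε > 0`, and `ψ`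
satisfies the mapping condition corresponding to `c₀ = 0` or to `c₀ ≥ 1`. Only the values of `φ`
on `Re s > 1/2` and those of `ψ` on `Re s > 0` matter. -/
def IsGordonHedenmalm (c₀ : ℕ) (φ : ℂ → ℂ) : Prop :=
  Set.MapsTo φ (halfPlane (1 / 2)) (halfPlane (1 / 2)) ∧
  ∃ (ψ : ℂ → ℂ) (c : ℕ → ℂ),
    (∀ s ∈ halfPlane (1 / 2), φ s = c₀ * s + ψ s) ∧
    (∀ ε : ℝ, 0 < ε →
      TendstoUniformlyOn (fun (N : ℕ) (s : ℂ) => ∑ n ∈ Finset.Icc 1 N, c n * (n : ℂ) ^ (-s))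
        ψ Filter.atTop (halfPlane ε)) ∧
    (c₀ = 0 → Set.MapsTo ψ (halfPlane 0) (halfPlane (1 / 2))) ∧
    (1 ≤ c₀ →
      (0 ≤ (c 1).re ∧ ∀ s ∈ halfPlane 0, ψ s = c 1) ∨
        Set.MapsTo ψ (halfPlane 0) (halfPlane 0))

/-- The bounded operator `T` is the composition operator `C_φ : f ↦ f ∘ φ`, as functions on the
half-plane `Re s > 1/2`. -/
def IsCompositionOperator (φ : ℂ → ℂ) (T : DirichletHilbert →L[ℂ] DirichletHilbert) : Prop :=
  ∀ f : DirichletHilbert, ∀ s ∈ halfPlane (1 / 2), (T f).eval s = f.eval (φ s)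

/-- The set of compact composition operators whose symbol belongs to the Gordon-Hedenmalm class
and has characteristic `c₀`. -/
def compactCompositionOperators (c₀ : ℕ) :
    Set (DirichletHilbert →L[ℂ] DirichletHilbert) :=
  {T | IsCompactOperator T ∧ ∃ φ : ℂ → ℂ, IsGordonHedenmalm c₀ φ ∧ IsCompositionOperator φ T}

/-! Write T_σ f = f(· + σ). The T_σ are self-adjoint contractions, strongly but not norm continuous
in σ. Multiplying by a compact operator A upgrades this to norm continuity of T_σ A and A T_σ. If A
= C_φ, these have symbols φ(s + σ) and φ(s) + σ, which stay in the class, so A is joined to T_3 A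
T_K for any K ≥ 0, with symbol c₀ s + ψ(s + 3) + d, d = 3c₀ + K.

The shift by 3 makes the Dirichlet series of ψ converge absolutely, so multiplication by ψ(s + 3) is
a bounded operator M. Since n^{-(c₀ s + rψ(s + 3) + d)} = n^{-d} exp(-r log n · ψ(s + 3)) n^{-c₀ s},
the operator with symbol c₀ s + rψ(s + 3) + d is a series of rank-one operators of norm at most
n^{‖M‖ - d}. For d ≥ ‖M‖ + 2 it converges in norm, uniformly in r ∈ [0, 1], so r can be lowered from
1 to 0. What remains is c₀ s + d, joined by a translation to one fixed base point.

The main lemmas are `IsCompactOperator.continuous_comp_left`,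
`IsCompactOperator.continuous_comp_right` and `exists_continuousOn_isCompositionOperator`. -/

open Filter Topology Set
open scoped NNReal InnerProductSpace

/-! ### Compactness turns strong continuity into norm continuity -/

section CompactOperators

variable {E F G : Type*} [NormedAddCommGroup E] [NormedSpace ℂ E] [NormedAddCommGroup F]
  [NormedSpace ℂ F] [NormedAddCommGroup G] [NormedSpace ℂ G]

/-- A bounded family of operators tending strongly to zero tends to zero in norm after composition
with a compact operator. -/
theorem IsCompactOperator.tendsto_comp_zero {ι : Type*} {l : Filter ι} {D : ι → F →L[ℂ] G} {C : ℝ}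
    (hC : ∀ i, ‖D i‖ ≤ C) (hD : ∀ x, Tendsto (fun i => D i x) l (𝓝 0)) {K : E →L[ℂ] F}
    (hK : IsCompactOperator K) : Tendsto (fun i => (D i).comp K) l (𝓝 0) := by
  rw [Metric.tendsto_nhds]
  intro ε hε
  rcases isEmpty_or_nonempty ι with hι | ⟨⟨i₀⟩⟩
  · exact Eventually.of_forall fun i => (hι.false i).elim
  have hC0 : 0 ≤ C := (norm_nonneg _).trans (hC i₀)
  obtain ⟨S, hS, hKS⟩ := IsCompactOperator.image_closedBall_subset_compact
    (f := (K : E →ₗ[ℂ] F)) hK 1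
  -- Strong convergence is uniform on a finite net of the compact set; the bound C controls the
  -- rest. Using C + 1 avoids dividing by zero.
  obtain ⟨t, ht, hSt⟩ := Metric.totallyBounded_iff.1 hS.totallyBounded (ε / (4 * (C + 1)))
    (by positivity)
  have hev : ∀ᶠ i in l, ∀ y ∈ t, ‖D i y‖ < ε / 4 := by
    refine (eventually_all_finite ht).2 fun y _ => ?_
    have h := (hD y).norm
    rw [norm_zero] at h
    exact h.eventually_lt_const (by positivity)
  filter_upwards [hev] with i hi
  rw [dist_zero_right]
  refine lt_of_le_of_lt (ContinuousLinearMap.opNorm_le_of_unit_norm (C := ε / 2)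
    (by positivity) fun x hx => ?_) (by linarith)
  have hx' : K x ∈ S := hKS ⟨x, by simp [hx], rfl⟩
  obtain ⟨y, hy, hxy⟩ := mem_iUnion₂.1 (hSt hx')
  rw [Metric.mem_ball, dist_eq_norm] at hxy
  have h1 : D i (K x) = D i y + D i (K x - y) := by rw [← map_add]; congr 1; abel
  have h2 : ‖D i (K x - y)‖ ≤ ε / 4 := by
    calc ‖D i (K x - y)‖ ≤ C * (ε / (4 * (C + 1))) :=
          (D i).le_of_opNorm_le_of_le (hC i) hxy.le
      _ ≤ (C + 1) * (ε / (4 * (C + 1))) := by gcongr; linarith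
      _ = ε / 4 := by field_simp
  calc ‖(D i).comp K x‖ = ‖D i y + D i (K x - y)‖ := by rw [← h1]; rfl
    _ ≤ ‖D i y‖ + ‖D i (K x - y)‖ := norm_add_le _ _
    _ ≤ ε / 2 := by linarith [hi y hy]

theorem IsCompactOperator.continuous_comp_left {X : Type*} [TopologicalSpace X]
    {T : X → F →L[ℂ] G} {C : ℝ} (hC : ∀ x, ‖T x‖ ≤ C) (hT : ∀ f, Continuous fun x => T x f)
    {K : E →L[ℂ] F} (hK : IsCompactOperator K) : Continuous fun x => (T x).comp K := by
  refine continuous_iff_continuousAt.2 fun x => ?_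
  have h := hK.tendsto_comp_zero (l := 𝓝 x) (D := fun y => T y - T x) (C := C + C)
    (fun y => (norm_sub_le _ _).trans (add_le_add (hC y) (hC x))) (fun f => by
      simpa using ((hT f).tendsto x).sub_const (T x f))
  have h' := h.add_const ((T x).comp K)
  simpa [ContinuousAt, ContinuousLinearMap.sub_comp] using h'

end CompactOperators

/-- Composing a compact operator on the right with a bounded, strongly continuous family of
self-adjoint operators gives a norm continuous family. -/
theorem IsCompactOperator.continuous_comp_right {H : Type*} [NormedAddCommGroup H]
    [InnerProductSpace ℂ H] [CompleteSpace H] {X : Type*} [TopologicalSpace X]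
    {T : X → H →L[ℂ] H} {C : ℝ} (hC : ∀ x, ‖T x‖ ≤ C) (hT : ∀ f, Continuous fun x => T x f)
    (hsa : ∀ x, IsSelfAdjoint (T x)) {K : H →L[ℂ] H} (hK : IsCompactOperator K) :
    Continuous fun x => K.comp (T x) := by
  refine continuous_iff_continuousAt.2 fun x => ?_
  have hKK : IsCompactOperator ((star K).comp K) := hK.clm_comp (star K)
  have h : Tendsto (fun y => (T y - T x).comp ((star K).comp K)) (𝓝 x) (𝓝 0) :=
    hKK.tendsto_comp_zero (D := fun y => T y - T x) (C := C + C)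
      (fun y => (norm_sub_le _ _).trans (add_le_add (hC y) (hC x))) (fun f => by
        simpa using ((hT f).tendsto x).sub_const (T x f))
  -- With D = T y - T x self-adjoint, the C*-identity gives ‖KD‖² = ‖D K*K D‖ ≤ ‖D K*K‖ ‖D‖, which
  -- puts a compact factor to the right of D.
  have hb : ∀ y, ‖K * (T y - T x)‖ * ‖K * (T y - T x)‖ ≤
      ‖(T y - T x).comp ((star K).comp K)‖ * (C + C) := fun y => by
    rw [← CStarRing.norm_star_mul_self]
    have hs : star (K * (T y - T x)) = (T y - T x) * star K := by
      rw [star_mul, star_sub, (hsa y).star_eq, (hsa x).star_eq]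
    rw [hs, show (T y - T x) * star K * (K * (T y - T x)) =
      ((T y - T x) * (star K * K)) * (T y - T x) by simp only [mul_assoc]]
    refine (norm_mul_le _ _).trans ?_
    gcongr
    · exact le_rfl
    · exact (norm_sub_le _ _).trans (add_le_add (hC y) (hC x))
  have h0 : Tendsto (fun y => ‖K * (T y - T x)‖ * ‖K * (T y - T x)‖) (𝓝 x) (𝓝 0) := by
    refine squeeze_zero (fun y => by positivity) hb ?_
    simpa using h.norm.mul_const (C + C)
  have h1 : Tendsto (fun y => ‖K * (T y - T x)‖) (𝓝 x) (𝓝 0) := by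
    have := h0.sqrt
    simpa [Real.sqrt_mul_self] using this
  rw [ContinuousAt, tendsto_iff_norm_sub_tendsto_zero]
  refine h1.congr fun y => ?_
  rw [mul_sub]
  rfl

/-! ### Exponentials of bounded operators -/

/-- An eigenvector of the transpose of `M` is an eigenvector of the transpose of `exp M`. -/
theorem ContinuousLinearMap.apply_exp_of_eigen {H : Type*} [NormedAddCommGroup H]
    [NormedSpace ℂ H] [CompleteSpace H] {L : H →L[ℂ] ℂ} {M : H →L[ℂ] H} {μ : ℂ}
    (h : ∀ f, L (M f) = μ * L f) (f : H) :
    L (NormedSpace.exp M f) = Complex.exp μ * L f := by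
  have hpow : ∀ (k : ℕ) (f : H), L ((M ^ k) f) = μ ^ k * L f := by
    intro k
    induction k with
    | zero => intro f; simp
    | succ k ih =>
      intro f
      rw [pow_succ, mul_apply_eq_comp, ih, h, pow_succ, mul_assoc]
  have h1 := (NormedSpace.exp_series_hasSum_exp' (𝕂 := ℂ) M).mapL
    (L.comp (ContinuousLinearMap.apply ℂ H f))
  have h2 := (NormedSpace.exp_series_hasSum_exp' (𝕂 := ℂ) μ).mul_right (L f)
  rw [← Complex.exp_eq_exp_ℂ] at h2
  refine h1.unique (h2.congr_fun ?_)
  intro k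
  simp [mul_assoc]
  exact Or.inl (by simpa using hpow k f)

theorem ContinuousLinearMap.norm_exp_le {H : Type*} [NormedAddCommGroup H] [NormedSpace ℂ H]
    [CompleteSpace H] (M : H →L[ℂ] H) : ‖NormedSpace.exp M‖ ≤ Real.exp ‖M‖ := by
  have h1 := NormedSpace.exp_series_hasSum_exp' (𝕂 := ℂ) M
  have h2 := NormedSpace.exp_series_hasSum_exp' (𝕂 := ℝ) ‖M‖
  rw [← Real.exp_eq_exp_ℝ] at h2
  rw [← h1.tsum_eq]
  refine tsum_of_norm_bounded h2 fun k => ?_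
  rw [norm_smul, smul_eq_mul]
  gcongr
  · simp
  -- The exponent 0 is separate because the identity has norm 0 when H is trivial.
  · rcases k with _ | k
    · rw [pow_zero, pow_zero]
      exact ContinuousLinearMap.norm_id_le
    · exact norm_pow_le' M k.succ_pos

theorem ContinuousLinearMap.continuous_exp {H : Type*} [NormedAddCommGroup H] [NormedSpace ℂ H]
    [CompleteSpace H] : Continuous (NormedSpace.exp : (H →L[ℂ] H) → H →L[ℂ] H) := by
  let _ : NormedAlgebra ℚ (H →L[ℂ] H) := NormedAlgebra.restrictScalars ℚ ℂ _
  exact NormedSpace.exp_continuous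

/-! ### Point evaluations and multiplication operators -/

namespace DirichletHilbert

theorem natCast_cpow_eq_exp (n : ℕ+) (z : ℂ) :
    ((n : ℕ) : ℂ) ^ z = Complex.exp ((Real.log n : ℂ) * z) := by
  rw [Complex.cpow_def_of_ne_zero (by exact_mod_cast n.ne_zero), ← Complex.natCast_log]

theorem memℓp_natCast_cpow {s : ℂ} (hs : s ∈ halfPlane (1 / 2)) :
    Memℓp (fun n : ℕ+ => (starRingEnd ℂ) (((n : ℕ) : ℂ) ^ (-s))) 2 := by
  refine memℓp_gen ?_
  have hs' : (1 / 2 : ℝ) < s.re := hs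
  have h2 : Summable fun n : ℕ+ => ((n : ℕ) : ℝ) ^ (-(2 * s.re)) :=
    (Real.summable_nat_rpow.2 (by linarith)).comp_injective PNat.coe_injective
  refine h2.congr fun n => ?_
  rw [RCLike.norm_conj, Complex.norm_natCast_cpow_of_pos n.pos, ← Real.rpow_mul (by positivity)]
  congr 1
  simp
  ring

/-- Evaluation at a point of `Re s > 1/2` as a continuous linear functional. -/
noncomputable def evalCLM (s : ℂ) (hs : s ∈ halfPlane (1 / 2)) : DirichletHilbert →L[ℂ] ℂ :=
  innerSL ℂ (⟨_, memℓp_natCast_cpow hs⟩ : DirichletHilbert)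

theorem evalCLM_apply {s : ℂ} (hs : s ∈ halfPlane (1 / 2)) (f : DirichletHilbert) :
    evalCLM s hs f = f.eval s := by
  rw [evalCLM, innerSL_apply_apply, lp.inner_eq_tsum, eval]
  exact tsum_congr fun n => by simp

/-- The basis vector representing the function `n^{-s}`. -/
noncomputable def monomial (n : ℕ+) : DirichletHilbert := lp.single 2 n 1

theorem norm_monomial (n : ℕ+) : ‖monomial n‖ = 1 := by
  rw [monomial, lp.norm_single (by norm_num), norm_one]

theorem eval_monomial (n : ℕ+) (s : ℂ) : (monomial n).eval s = ((n : ℕ) : ℂ) ^ (-s) := by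
  rw [eval, tsum_eq_single n]
  · simp [monomial]
  · intro m hm
    simp [monomial, hm]

theorem orthonormal_monomial : Orthonormal ℂ monomial := by
  refine ⟨norm_monomial, fun m n hmn => ?_⟩
  change inner ℂ (lp.single 2 m 1 : DirichletHilbert) (monomial n) = 0
  rw [lp.inner_single_left]
  simp [monomial, hmn]

/-- Multiplication by `n^{-s}`. -/
noncomputable def mulMonomial (n : ℕ+) : DirichletHilbert →ₗᵢ[ℂ] DirichletHilbert :=
  -- The basis vector of index k goes to that of index nk, and k ↦ nk is injective.
  (orthonormal_monomial.comp (fun k => n * k) (mul_right_injective n)).orthogonalFamily.linearIsometry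

theorem eval_mulMonomial (n : ℕ+) (f : DirichletHilbert) {s : ℂ} (hs : s ∈ halfPlane (1 / 2)) :
    (mulMonomial n f).eval s = ((n : ℕ) : ℂ) ^ (-s) * f.eval s := by
  have h := ((orthonormal_monomial.comp (fun k => n * k)
    (mul_right_injective n)).orthogonalFamily.hasSum_linearIsometry f).mapL (evalCLM s hs)
  have h' := ((summable_eval f hs).hasSum).mul_left (((n : ℕ) : ℂ) ^ (-s))
  rw [← evalCLM_apply hs]
  refine h.unique (h'.congr_fun fun k => ?_)
  simp only [LinearIsometry.toSpanSingleton_apply, map_smul, Function.comp_apply,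
    evalCLM_apply, eval_monomial, smul_eq_mul, PNat.mul_coe, Nat.cast_mul]
  rw [Complex.natCast_mul_natCast_cpow]
  ring

/-- Multiplication by an absolutely convergent Dirichlet series. -/
theorem exists_mul_operator {a : ℕ+ → ℂ} (ha : Summable fun n => ‖a n‖) :
    ∃ M : DirichletHilbert →L[ℂ] DirichletHilbert, ∀ f : DirichletHilbert,
      ∀ s ∈ halfPlane (1 / 2), (M f).eval s = (∑' n : ℕ+, a n * ((n : ℕ) : ℂ) ^ (-s)) * f.eval s := by
  have hs : Summable fun n => a n • (mulMonomial n).toContinuousLinearMap := by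
    refine Summable.of_norm_bounded ha fun n => ?_
    rw [norm_smul]
    exact mul_le_of_le_one_right (norm_nonneg _) (mulMonomial n).norm_toContinuousLinearMap_le
  refine ⟨∑' n, a n • (mulMonomial n).toContinuousLinearMap, fun f s hs' => ?_⟩
  have h := hs.hasSum.mapL ((evalCLM s hs').comp (ContinuousLinearMap.apply ℂ _ f))
  rw [← evalCLM_apply hs', ← tsum_mul_right]
  refine h.tsum_eq.symm.trans (tsum_congr fun n => ?_)
  simp [evalCLM_apply, eval_mulMonomial n f hs', mul_assoc]

theorem lseries_eq_eval (f : DirichletHilbert) (s : ℂ) :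
    LSeries (fun n => if h : 0 < n then f ⟨n, h⟩ else 0) s = f.eval s := by
  rw [LSeries, eval, ← PNat.coe_injective.tsum_eq]
  · refine tsum_congr fun n => ?_
    rw [LSeries.term_of_ne_zero n.ne_zero, dif_pos n.pos, Complex.cpow_neg, div_eq_mul_inv]
    rfl
  · intro n hn
    rcases Nat.eq_zero_or_pos n with rfl | h
    · simp at hn
    · exact ⟨⟨n, h⟩, rfl⟩

theorem abscissaOfAbsConv_lt_top (f : DirichletHilbert) :
    LSeries.abscissaOfAbsConv (fun n => if h : 0 < n then f ⟨n, h⟩ else 0) < ⊤ := by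
  have h1 : (1 : ℂ) ∈ halfPlane (1 / 2) := by simp [halfPlane]; norm_num
  have hs : LSeriesSummable (fun n => if h : 0 < n then f ⟨n, h⟩ else 0) 1 := by
    rw [LSeriesSummable, ← PNat.coe_injective.summable_iff]
    · refine (summable_eval f h1).congr fun n => ?_
      rw [Function.comp_apply, LSeries.term_of_ne_zero n.ne_zero, dif_pos n.pos, Complex.cpow_neg,
        div_eq_mul_inv]
      rfl
    · intro n hn
      rcases Nat.eq_zero_or_pos n with rfl | h
      · simp
      · exact (hn ⟨⟨n, h⟩, rfl⟩).elim
  exact hs.abscissaOfAbsConv_le.trans_lt (EReal.coe_lt_top _)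

/-- The coefficients are determined by the values on the half-plane `Re s > 1/2`. -/
theorem ext_eval {f g : DirichletHilbert} (h : ∀ s ∈ halfPlane (1 / 2), f.eval s = g.eval s) :
    f = g := by
  refine lp.ext (funext fun n => ?_)
  have := LSeries.eq_of_LSeries_eventually_eq (abscissaOfAbsConv_lt_top f)
    (abscissaOfAbsConv_lt_top g) (n := n) (by
      filter_upwards [eventually_gt_atTop (1 / 2 : ℝ)] with x hx
      rw [lseries_eq_eval, lseries_eq_eval]
      exact h x (by simpa [halfPlane] using hx)) n.ne_zero
  rw [dif_pos n.pos, dif_pos n.pos] at this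
  exact this

/-! ### The translation semigroup -/

theorem norm_natCast_cpow_neg_mul_le (σ : ℝ≥0) (n : ℕ+) (z : ℂ) :
    ‖((n : ℕ) : ℂ) ^ (-((σ : ℝ) : ℂ)) * z‖ ≤ ‖z‖ := by
  rw [norm_mul, Complex.norm_natCast_cpow_of_pos n.pos]
  refine mul_le_of_le_one_left (norm_nonneg _) ?_
  refine Real.rpow_le_one_of_one_le_of_nonpos (by exact_mod_cast n.pos) ?_
  simp

/-- The operator `f ↦ f(· + σ)`. -/
noncomputable def translation (σ : ℝ≥0) : DirichletHilbert →L[ℂ] DirichletHilbert :=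
  LinearMap.mkContinuous
    { toFun := fun f => ⟨fun n => ((n : ℕ) : ℂ) ^ (-((σ : ℝ) : ℂ)) * f n,
        (lp.memℓp f).mono' fun n => norm_natCast_cpow_neg_mul_le σ n (f n)⟩
      map_add' := fun f g => lp.ext (funext fun n => mul_add _ _ _)
      map_smul' := fun c f => lp.ext (funext fun n => mul_left_comm _ _ _) } 1 (fun f => by
    rw [one_mul]
    exact lp.norm_mono (by norm_num) fun n => norm_natCast_cpow_neg_mul_le σ n (f n))

theorem translation_apply (σ : ℝ≥0) (f : DirichletHilbert) (n : ℕ+) :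
    translation σ f n = ((n : ℕ) : ℂ) ^ (-((σ : ℝ) : ℂ)) * f n := rfl

theorem norm_translation_le (σ : ℝ≥0) : ‖translation σ‖ ≤ 1 :=
  LinearMap.mkContinuous_norm_le _ zero_le_one _

theorem translation_zero : translation 0 = ContinuousLinearMap.id ℂ DirichletHilbert := by
  ext f n
  simp [translation_apply]

theorem eval_translation (σ : ℝ≥0) (f : DirichletHilbert) (s : ℂ) :
    (translation σ f).eval s = f.eval (s + (σ : ℝ)) := by
  refine tsum_congr fun n => ?_
  rw [translation_apply, neg_add, Complex.cpow_add _ _ (by exact_mod_cast n.ne_zero)]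
  ring

theorem isSelfAdjoint_translation (σ : ℝ≥0) : IsSelfAdjoint (translation σ) := by
  rw [ContinuousLinearMap.isSelfAdjoint_iff_isSymmetric]
  intro f g
  change inner ℂ (translation σ f) g = inner ℂ f (translation σ g)
  rw [lp.inner_eq_tsum, lp.inner_eq_tsum]
  refine tsum_congr fun n => ?_
  have hr : (starRingEnd ℂ) (((n : ℕ) : ℂ) ^ (-((σ : ℝ) : ℂ))) =
      ((n : ℕ) : ℂ) ^ (-((σ : ℝ) : ℂ)) := by
    rw [natCast_cpow_eq_exp, ← Complex.exp_conj, map_mul, map_neg, Complex.conj_ofReal,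
      Complex.conj_ofReal]
  simp only [translation_apply, RCLike.inner_apply, map_mul, hr]
  ring

theorem continuous_translation_apply (f : DirichletHilbert) :
    Continuous fun σ => translation σ f := by
  refine continuous_iff_continuousAt.2 fun σ => ?_
  rw [ContinuousAt, tendsto_iff_norm_sub_tendsto_zero]
  have hnorm : ∀ g : DirichletHilbert, ‖g‖ = √(∑' n, ‖g n‖ ^ 2) := fun g => by
    rw [eq_comm, Real.sqrt_eq_iff_eq_sq (tsum_nonneg fun _ => by positivity) (norm_nonneg _)]
    have := lp.norm_rpow_eq_tsum (p := 2) (by norm_num) g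
    simpa using this.symm
  have hsum : Summable fun n : ℕ+ => (2 * ‖f n‖) ^ 2 := by
    have h := (lp.memℓp f).summable (by norm_num)
    have h' : Summable fun n : ℕ+ => ‖f n‖ ^ 2 := by simpa using h
    simpa only [mul_pow] using h'.mul_left (2 ^ 2)
  -- Dominated convergence on coefficients: each difference is at most 2‖f n‖.
  have ht : Tendsto (fun τ => ∑' n, ‖(translation τ f - translation σ f) n‖ ^ 2) (𝓝 σ)
      (𝓝 (∑' _ : ℕ+, (0 : ℝ))) := by
    refine tendsto_tsum_of_dominated_convergence hsum (fun n => ?_)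
      (Eventually.of_forall fun τ n => ?_)
    · have hc : Continuous fun τ : ℝ≥0 => ‖(translation τ f - translation σ f) n‖ ^ 2 := by
        simp only [lp.coeFn_sub, Pi.sub_apply, translation_apply, natCast_cpow_eq_exp]
        fun_prop
      simpa using hc.tendsto σ
    · rw [Real.norm_of_nonneg (by positivity)]
      gcongr
      rw [lp.coeFn_sub, Pi.sub_apply, two_mul]
      exact (norm_sub_le _ _).trans (add_le_add
        (norm_natCast_cpow_neg_mul_le τ n _) (norm_natCast_cpow_neg_mul_le σ n _))
  rw [tsum_zero] at ht
  have := ht.sqrt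
  rw [Real.sqrt_zero] at this
  exact this.congr fun τ => (hnorm _).symm

end DirichletHilbert

/-! ### Uniformly convergent Dirichlet series and their absolutely convergent shifts -/

/-- The Dirichlet series `∑ cₙ n^{-s}` converges to `ψ` uniformly on `Re s > ε` for all `ε > 0`. -/
def HasUniformDirichletSeries (ψ : ℂ → ℂ) (c : ℕ → ℂ) : Prop :=
  ∀ ε : ℝ, 0 < ε →
    TendstoUniformlyOn (fun (N : ℕ) (s : ℂ) => ∑ n ∈ Finset.Icc 1 N, c n * (n : ℂ) ^ (-s))
      ψ atTop (halfPlane ε)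

namespace HasUniformDirichletSeries

variable {ψ : ℂ → ℂ} {c : ℕ → ℂ}

theorem affine (h : HasUniformDirichletSeries ψ c) (r d : ℂ) {τ : ℝ} (hτ : 0 ≤ τ) :
    HasUniformDirichletSeries (fun s => r * ψ (s + τ) + d)
      (fun n => r * (c n * (n : ℂ) ^ (-(τ : ℂ))) + if n = 1 then d else 0) := by
  intro ε hε
  have h' := h ε hε
  rw [Metric.tendstoUniformlyOn_iff] at h' ⊢
  intro δ hδ
  filter_upwards [h' (δ / (‖r‖ + 1)) (by positivity), eventually_ge_atTop 1] with N hN hN1 s hs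
  have hs' : s + τ ∈ halfPlane ε := by
    have : ε < s.re := hs
    simp only [halfPlane, mem_ofPred_eq, Complex.add_re, Complex.ofReal_re]
    linarith
  have hsum : ∑ n ∈ Finset.Icc 1 N,
      (r * (c n * (n : ℂ) ^ (-(τ : ℂ))) + if n = 1 then d else 0) * (n : ℂ) ^ (-s) =
      r * ∑ n ∈ Finset.Icc 1 N, c n * (n : ℂ) ^ (-(s + τ)) + d := by
    have h1 : ∑ n ∈ Finset.Icc 1 N, (if n = 1 then d else 0) * (n : ℂ) ^ (-s) = d := by
      rw [Finset.sum_eq_single 1]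
      · simp
      · intro n _ hn; simp [hn]
      · intro hn; simp [hN1] at hn
    conv_rhs => rw [← h1]
    rw [Finset.mul_sum, ← Finset.sum_add_distrib]
    refine Finset.sum_congr rfl fun n hn => ?_
    have hn0 : (n : ℂ) ≠ 0 := by
      have := (Finset.mem_Icc.1 hn).1
      exact_mod_cast (by omega : n ≠ 0)
    rw [neg_add, Complex.cpow_add _ _ hn0]
    ring
  have h2 := hN (s + τ) hs'
  rw [dist_eq_norm] at h2 ⊢
  rw [hsum, add_sub_add_right_eq_sub, ← mul_sub, norm_mul]
  calc _ ≤ ‖r‖ * (δ / (‖r‖ + 1)) := by gcongr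
    _ < (‖r‖ + 1) * (δ / (‖r‖ + 1)) := by gcongr; linarith
    _ = δ := by field_simp

/-- Convergence at s = 1 makes the terms c n / n bounded, as differences of consecutive partial
sums. -/
theorem exists_norm_le (h : HasUniformDirichletSeries ψ c) :
    ∃ B, ∀ n : ℕ+, ‖c n‖ ≤ B * (n : ℕ) := by
  have h1 : (1 : ℂ) ∈ halfPlane (1 / 2) := by simp [halfPlane]; norm_num
  have ht := (h (1 / 2) (by norm_num)).tendsto_at h1
  have hd := ((ht.comp (tendsto_add_atTop_nat 1)).sub ht).norm.bddAbove_range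
  obtain ⟨B, hB⟩ := hd
  refine ⟨B, fun n => ?_⟩
  obtain ⟨m, hm⟩ := Nat.exists_eq_succ_of_ne_zero n.ne_zero
  have hb := hB ⟨m, rfl⟩
  simp only [Function.comp_apply] at hb
  rw [Finset.sum_Icc_succ_top (by omega), add_sub_cancel_left, Complex.cpow_neg_one, norm_mul,
    norm_inv, Complex.norm_natCast] at hb
  rw [hm]
  rwa [← div_eq_mul_inv, div_le_iff₀ (by positivity)] at hb

/-- Coefficients of size O(n) become O(n^{-2}) after a shift by 3. -/
theorem summable_shift (h : HasUniformDirichletSeries ψ c) :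
    Summable fun n : ℕ+ => ‖c n * ((n : ℕ) : ℂ) ^ (-3 : ℂ)‖ := by
  obtain ⟨B, hB⟩ := h.exists_norm_le
  have hs : Summable fun n : ℕ+ => B * ((n : ℕ) : ℝ) ^ (-2 : ℝ) :=
    ((Real.summable_nat_rpow.2 (by norm_num)).comp_injective PNat.coe_injective).mul_left B
  refine Summable.of_nonneg_of_le (fun _ => norm_nonneg _) (fun n => ?_) hs
  have hn : (0 : ℝ) < ((n : ℕ) : ℝ) := by exact_mod_cast n.pos
  rw [norm_mul, Complex.norm_natCast_cpow_of_pos n.pos]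
  calc _ ≤ B * (n : ℕ) * ((n : ℕ) : ℝ) ^ (-3 : ℂ).re := by gcongr; exact hB n
    _ = B * ((n : ℕ) : ℝ) ^ (-2 : ℝ) := by
      rw [mul_assoc]
      congr 1
      nth_rw 1 [← Real.rpow_one ((n : ℕ) : ℝ)]
      rw [← Real.rpow_add hn]
      norm_num

theorem apply_shift (h : HasUniformDirichletSeries ψ c) {s : ℂ} (hs : s ∈ halfPlane 0) :
    ψ (s + 3) = ∑' n : ℕ+, c n * ((n : ℕ) : ℂ) ^ (-3 : ℂ) * ((n : ℕ) : ℂ) ^ (-s) := by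
  have hs0 : 0 < s.re := hs
  have hmem : s + 3 ∈ halfPlane 1 := by
    simp only [halfPlane, mem_ofPred_eq, Complex.add_re, Complex.re_ofNat]
    linarith
  have ht := (h 1 one_pos).tendsto_at hmem
  have hsum : Summable fun n : ℕ+ => c n * ((n : ℕ) : ℂ) ^ (-(s + 3)) := by
    refine Summable.of_norm_bounded h.summable_shift fun n => ?_
    rw [norm_mul, norm_mul, Complex.norm_natCast_cpow_of_pos n.pos,
      Complex.norm_natCast_cpow_of_pos n.pos]
    exact mul_le_mul_of_nonneg_left (Real.rpow_le_rpow_of_exponent_le (by exact_mod_cast n.pos)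
      (by simp; linarith)) (norm_nonneg _)
  have hsum' := (hasSum_pnat_iff_hasSum_succ
    (f := fun n : ℕ => c n * (n : ℂ) ^ (-(s + 3)))).1 hsum.hasSum
  have ht' := hsum'.tendsto_sum_nat
  have heq : ∀ N : ℕ, ∑ n ∈ Finset.Icc 1 N, c n * (n : ℂ) ^ (-(s + 3)) =
      ∑ i ∈ Finset.range N, c (i + 1) * ((i + 1 : ℕ) : ℂ) ^ (-(s + 3)) := fun N => by
    induction N with
    | zero => simp
    | succ N ih => rw [Finset.sum_Icc_succ_top (by omega), Finset.sum_range_succ, ih]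
  rw [tendsto_nhds_unique ht (ht'.congr fun N => (heq N).symm)]
  refine tsum_congr fun n => ?_
  rw [neg_add_rev, Complex.cpow_add _ _ (by exact_mod_cast n.ne_zero), mul_assoc]

end HasUniformDirichletSeries

/-! ### Stability of the Gordon-Hedenmalm class -/

theorem IsGordonHedenmalm.add_const {c₀ : ℕ} {φ : ℂ → ℂ} (h : IsGordonHedenmalm c₀ φ) (σ : ℝ≥0) :
    IsGordonHedenmalm c₀ (fun s => φ s + (σ : ℝ)) := by
  obtain ⟨hφ, ψ, c, hψ, hc, h0, h1⟩ := h
  have hσ : (0 : ℝ) ≤ σ := σ.2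
  refine ⟨fun s hs => ?_, _, _, fun s hs => ?_,
    HasUniformDirichletSeries.affine hc 1 (σ : ℝ) le_rfl, fun h s hs => ?_, fun h => ?_⟩
  · have : 1 / 2 < (φ s).re := hφ hs
    simp only [halfPlane, mem_ofPred_eq, Complex.add_re, Complex.ofReal_re]
    linarith
  · simp [hψ s hs, add_assoc]
  · have : 1 / 2 < (ψ s).re := h0 h hs
    simp [halfPlane] at this ⊢
    linarith
  · rcases h1 h with ⟨h2, h3⟩ | h2
    · refine Or.inl ⟨?_, fun s hs => ?_⟩
      · simp
        linarith
      · simp [h3 s hs]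
    · refine Or.inr fun s hs => ?_
      have : 0 < (ψ s).re := h2 hs
      simp [halfPlane]
      linarith

theorem IsGordonHedenmalm.comp_add_const {c₀ : ℕ} {φ : ℂ → ℂ} (h : IsGordonHedenmalm c₀ φ)
    (σ : ℝ≥0) : IsGordonHedenmalm c₀ (fun s => φ (s + (σ : ℝ))) := by
  obtain ⟨hφ, ψ, c, hψ, hc, h0, h1⟩ := h
  have hσ : (0 : ℝ) ≤ σ := σ.2
  have hshift : ∀ (θ : ℝ) (s : ℂ), s ∈ halfPlane θ → s + (σ : ℝ) ∈ halfPlane θ := fun θ s hs => by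
    have : θ < s.re := hs
    simp only [halfPlane, mem_ofPred_eq, Complex.add_re, Complex.ofReal_re]
    linarith
  have hnn : (0 : ℝ) ≤ c₀ * σ := by positivity
  -- The extra c₀σ produced by c₀(s + σ) is absorbed into the constant coefficient.
  refine ⟨fun s hs => hφ (hshift _ s hs), _, _, fun s hs => ?_,
    HasUniformDirichletSeries.affine hc 1 (c₀ * (σ : ℝ)) hσ, fun h s hs => ?_, fun h => ?_⟩
  · simp only [hψ _ (hshift _ s hs)]
    ring
  · have : 1 / 2 < (ψ (s + (σ : ℝ))).re := h0 h (hshift _ s hs)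
    simpa [halfPlane, h] using this
  · rcases h1 h with ⟨h2, h3⟩ | h2
    · refine Or.inl ⟨?_, fun s hs => ?_⟩
      · simp
        linarith
      · simpa using h3 _ (hshift _ s hs)
    · refine Or.inr fun s hs => ?_
      have : 0 < (ψ (s + (σ : ℝ))).re := h2 (hshift _ s hs)
      simp [halfPlane]
      linarith

/-- The symbols obtained by contracting `ψ` radially towards a large constant. -/
theorem isGordonHedenmalm_affine {c₀ : ℕ} {ψ : ℂ → ℂ} {c : ℕ → ℂ}
    (h : HasUniformDirichletSeries ψ c) (hre : ∀ s ∈ halfPlane 0, 0 ≤ (ψ s).re) {r d : ℝ}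
    (hr : 0 ≤ r) (hd : 1 ≤ d) :
    IsGordonHedenmalm c₀ (fun s => c₀ * s + (r * ψ (s + 3) + d)) := by
  -- As d ≥ 1, the real part exceeds 1/2, which settles the mapping conditions for c₀ = 0 and c₀ ≥ 1
  -- together.
  have hre' : ∀ s ∈ halfPlane 0, 1 / 2 < (r * ψ (s + (3 : ℝ)) + d : ℂ).re := fun s hs => by
    have h3 : s + (3 : ℝ) ∈ halfPlane 0 := by
      have : 0 < s.re := hs
      simp only [halfPlane, mem_ofPred_eq, Complex.add_re, Complex.ofReal_re]
      linarith
    have := mul_nonneg hr (hre _ h3)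
    simp at this ⊢
    linarith
  refine ⟨fun s hs => ?_, fun s => r * ψ (s + (3 : ℝ)) + d, _, fun s hs => by simp,
    h.affine r d (by norm_num), fun _ => hre',
    fun _ => Or.inr fun s hs => (by norm_num : (0 : ℝ) < 1 / 2).trans (hre' s hs)⟩
  have hs' : 1 / 2 < s.re := hs
  have h1 := hre' s (show 0 < s.re by linarith)
  have h2 : 0 ≤ (c₀ : ℝ) * s.re := by positivity
  simp [halfPlane] at h1 ⊢
  linarith

/-! ### Paths of compact composition operators -/

open DirichletHilbert

theorem IsCompositionOperator.unique {φ : ℂ → ℂ} {S T : DirichletHilbert →L[ℂ] DirichletHilbert}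
    (hS : IsCompositionOperator φ S) (hT : IsCompositionOperator φ T) : S = T :=
  ContinuousLinearMap.ext fun f => ext_eval fun s hs => (hS f s hs).trans (hT f s hs).symm

theorem comp_translation_mem {c₀ : ℕ} {T : DirichletHilbert →L[ℂ] DirichletHilbert}
    (hT : T ∈ compactCompositionOperators c₀) (σ : ℝ≥0) :
    T.comp (translation σ) ∈ compactCompositionOperators c₀ := by
  obtain ⟨hc, φ, hφ, hφT⟩ := hT
  exact ⟨hc.comp_clm _, _, hφ.add_const σ, fun f s hs => by
    rw [ContinuousLinearMap.comp_apply, hφT _ s hs, eval_translation]⟩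

theorem translation_comp_mem {c₀ : ℕ} {T : DirichletHilbert →L[ℂ] DirichletHilbert}
    (hT : T ∈ compactCompositionOperators c₀) (σ : ℝ≥0) :
    (translation σ).comp T ∈ compactCompositionOperators c₀ := by
  obtain ⟨hc, φ, hφ, hφT⟩ := hT
  refine ⟨hc.clm_comp (translation σ), _, hφ.comp_add_const σ, fun f s hs => ?_⟩
  rw [ContinuousLinearMap.comp_apply, eval_translation, hφT]
  have : 1 / 2 < s.re := hs
  have hσ : (0 : ℝ) ≤ σ := σ.2
  simp only [halfPlane, mem_ofPred_eq, Complex.add_re, Complex.ofReal_re]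
  linarith

theorem joinedIn_comp_translation {c₀ : ℕ} {T : DirichletHilbert →L[ℂ] DirichletHilbert}
    (hT : T ∈ compactCompositionOperators c₀) (σ : ℝ≥0) :
    JoinedIn (compactCompositionOperators c₀) T (T.comp (translation σ)) := by
  have hc : Continuous fun τ => T.comp (translation τ) :=
    hT.1.continuous_comp_right norm_translation_le continuous_translation_apply
      isSelfAdjoint_translation
  refine JoinedIn.ofLine (f := fun t : ℝ => T.comp (translation (t.toNNReal * σ)))
    (hc.comp (by fun_prop)).continuousOn ?_ ?_ ?_
  · simp [translation_zero]
  · simp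
  · rintro _ ⟨t, -, rfl⟩
    exact comp_translation_mem hT _

theorem joinedIn_translation_comp {c₀ : ℕ} {T : DirichletHilbert →L[ℂ] DirichletHilbert}
    (hT : T ∈ compactCompositionOperators c₀) (σ : ℝ≥0) :
    JoinedIn (compactCompositionOperators c₀) T ((translation σ).comp T) := by
  have hc : Continuous fun τ => (translation τ).comp T :=
    hT.1.continuous_comp_left norm_translation_le continuous_translation_apply
  refine JoinedIn.ofLine (f := fun t : ℝ => (translation (t.toNNReal * σ)).comp T)
    (hc.comp (by fun_prop)).continuousOn ?_ ?_ ?_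
  · simp [translation_zero]
  · simp
  · rintro _ ⟨t, -, rfl⟩
    exact translation_comp_mem hT _

/-- For large `d`, the symbols `c₀ s + r ∑ aₙ n^{-s} + d`, `0 ≤ r ≤ 1`, induce a norm continuous
family of nuclear composition operators. -/
theorem exists_continuousOn_isCompositionOperator (c₀ : ℕ) {a : ℕ+ → ℂ}
    (ha : Summable fun n => ‖a n‖) :
    ∃ C : ℝ, ∀ d : ℝ, C ≤ d → ∃ B : ℝ → DirichletHilbert →L[ℂ] DirichletHilbert,
      ContinuousOn B (Icc 0 1) ∧ ∀ r ∈ Icc (0 : ℝ) 1, IsCompactOperator (B r) ∧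
        IsCompositionOperator
          (fun s => c₀ * s + (r * (∑' n : ℕ+, a n * ((n : ℕ) : ℂ) ^ (-s)) + d)) (B r) := by
  obtain ⟨M, hM⟩ := exists_mul_operator ha
  -- The rank-one operator sending f to f n times the function n^{-(c₀ s + rμ(s))}, where M is
  -- multiplication by μ.
  let L : ℝ → ℕ+ → DirichletHilbert →L[ℂ] DirichletHilbert := fun r n =>
    (lp.evalCLM ℂ (fun _ : ℕ+ => ℂ) 2 n).smulRight
      (NormedSpace.exp ((-(r * Real.log n : ℝ) : ℂ) • M) (monomial (n ^ c₀)))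
  have hLnorm : ∀ r ∈ Icc (0 : ℝ) 1, ∀ n, ‖L r n‖ ≤ ((n : ℕ) : ℝ) ^ ‖M‖ := by
    intro r hr n
    have hn : (0 : ℝ) < ((n : ℕ) : ℝ) := by exact_mod_cast n.pos
    have hlog : 0 ≤ Real.log n := Real.log_natCast_nonneg _
    have h1 : ‖lp.evalCLM ℂ (fun _ : ℕ+ => ℂ) 2 n‖ ≤ 1 :=
      ContinuousLinearMap.opNorm_le_bound _ zero_le_one fun f => by
        rw [one_mul]
        exact lp.norm_apply_le_norm (by norm_num) f n
    have h2 : ‖(-(r * Real.log n : ℝ) : ℂ) • M‖ ≤ Real.log n * ‖M‖ := by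
      rw [norm_smul, norm_neg, Complex.norm_real, Real.norm_of_nonneg (mul_nonneg hr.1 hlog)]
      gcongr
      exact mul_le_of_le_one_left hlog hr.2
    rw [ContinuousLinearMap.norm_smulRight_apply, Real.rpow_def_of_pos hn]
    refine (mul_le_of_le_one_left (norm_nonneg _) h1).trans ?_
    refine (ContinuousLinearMap.le_opNorm _ _).trans ?_
    rw [norm_monomial, mul_one]
    exact (ContinuousLinearMap.norm_exp_le _).trans (Real.exp_le_exp.2 h2)
  -- The factor n^{-d} must absorb n^{‖M‖} and leave the summable n^{-2}.
  refine ⟨‖M‖ + 2, fun d hd => ?_⟩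
  have hbound : ∀ (n : ℕ+), ∀ r ∈ Icc (0 : ℝ) 1,
      ‖((((n : ℕ) : ℝ) ^ (-d) : ℝ) : ℂ) • L r n‖ ≤ ((n : ℕ) : ℝ) ^ (-2 : ℝ) := fun n r hr => by
    have hn : (0 : ℝ) < ((n : ℕ) : ℝ) := by exact_mod_cast n.pos
    rw [norm_smul, Complex.norm_real, Real.norm_of_nonneg (by positivity)]
    calc _ ≤ ((n : ℕ) : ℝ) ^ (-d) * ((n : ℕ) : ℝ) ^ ‖M‖ := by gcongr; exact hLnorm r hr n
      _ = ((n : ℕ) : ℝ) ^ (-d + ‖M‖) := (Real.rpow_add hn _ _).symm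
      _ ≤ _ := Real.rpow_le_rpow_of_exponent_le (by exact_mod_cast n.pos) (by linarith)
  have hsum2 : Summable fun n : ℕ+ => ((n : ℕ) : ℝ) ^ (-2 : ℝ) :=
    (Real.summable_nat_rpow.2 (by norm_num)).comp_injective PNat.coe_injective
  refine ⟨fun r => ∑' n : ℕ+, ((((n : ℕ) : ℝ) ^ (-d) : ℝ) : ℂ) • L r n,
    continuousOn_tsum (fun n => ?_) hsum2 hbound, fun r hr => ?_⟩
  · have hexp : Continuous fun r : ℝ =>
        NormedSpace.exp ((-(r * Real.log n : ℝ) : ℂ) • M) :=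
      ContinuousLinearMap.continuous_exp.comp (by fun_prop)
    have hL : Continuous fun r => L r n :=
      ((ContinuousLinearMap.smulRightL ℂ DirichletHilbert DirichletHilbert
        (lp.evalCLM ℂ (fun _ : ℕ+ => ℂ) 2 n)).continuous).comp (hexp.clm_apply continuous_const)
    exact (hL.const_smul ((((n : ℕ) : ℝ) ^ (-d) : ℝ) : ℂ)).continuousOn
  · have hsum : Summable fun n : ℕ+ => ((((n : ℕ) : ℝ) ^ (-d) : ℝ) : ℂ) • L r n :=
      Summable.of_norm_bounded hsum2 fun n => hbound n r hr
    refine ⟨isCompactOperator_of_tendsto hsum.hasSum (Eventually.of_forall fun t => ?_),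
      fun f s hs => ?_⟩
    · refine Submodule.sum_mem (compactOperator (RingHom.id ℂ) DirichletHilbert DirichletHilbert)
        fun n _ => Submodule.smul_mem _ _ ?_
      have hev : IsCompactOperator (lp.evalCLM ℂ (fun _ : ℕ+ => ℂ) 2 n) :=
        isCompactOperator_of_locallyCompactSpace_dom (lp.evalCLM ℂ (fun _ : ℕ+ => ℂ) 2 n)
      exact hev.clm_comp (ContinuousLinearMap.toSpanSingleton ℂ
        (NormedSpace.exp ((-(r * Real.log n : ℝ) : ℂ) • M) (monomial (n ^ c₀))))
    · have h := hsum.hasSum.mapL ((evalCLM s hs).comp (ContinuousLinearMap.apply ℂ _ f))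
      rw [← evalCLM_apply hs]
      refine h.tsum_eq.symm.trans (tsum_congr fun n => ?_)
      set μ := ∑' n : ℕ+, a n * ((n : ℕ) : ℂ) ^ (-s)
      -- Evaluation at s is an eigenvector of the transpose of M with eigenvalue μ, so exponentials
      -- of M evaluate to scalar exponentials.
      have hμ : ∀ g, evalCLM s hs (((-(r * Real.log n : ℝ) : ℂ) • M) g) =
          (-(r * Real.log n : ℝ) : ℂ) * μ * evalCLM s hs g := fun g => by
        rw [smul_apply, map_smul, evalCLM_apply, evalCLM_apply, hM g s hs,
          smul_eq_mul, mul_assoc]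
      have he := ContinuousLinearMap.apply_exp_of_eigen hμ (monomial (n ^ c₀))
      have hL : evalCLM s hs (L r n f) = f n * (Complex.exp ((-(r * Real.log n : ℝ) : ℂ) * μ) *
          ((n ^ c₀ : ℕ+) : ℕ) ^ (-s)) := by
        rw [← eval_monomial, ← evalCLM_apply hs, ← he, ← smul_eq_mul, ← map_smul]
        rfl
      rw [ContinuousLinearMap.comp_apply, ContinuousLinearMap.apply_apply,
        smul_apply, map_smul, hL, smul_eq_mul, mul_left_comm,
        Complex.ofReal_cpow (by positivity), Complex.ofReal_natCast]
      change _ = f n * ((n : ℕ) : ℂ) ^ (-(c₀ * s + (r * μ + d)))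
      clear_value μ
      simp only [natCast_cpow_eq_exp]
      rw [← Complex.exp_add, ← Complex.exp_add]
      congr 2
      rw [PNat.pow_coe, Nat.cast_pow, Real.log_pow]
      push_cast
      ring

/-! ### Joining every operator to a base point -/

theorem mainTheorem6 (c₀ : ℕ) : IsPathConnected (compactCompositionOperators c₀) := by
  obtain ⟨C₀, hC₀⟩ := exists_continuousOn_isCompositionOperator c₀ (a := 0) (by simp)
  obtain ⟨B₀, -, hB₀⟩ := hC₀ (max C₀ 1) (le_max_left _ _)
  obtain ⟨hR, hRφ⟩ := hB₀ 0 (by simp)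
  have hzero : HasUniformDirichletSeries 0 0 := fun ε hε => by
    rw [Metric.tendstoUniformlyOn_iff]
    intro δ hδ
    simp [hδ]
  have hRmem : B₀ 0 ∈ compactCompositionOperators c₀ :=
    ⟨hR, _, isGordonHedenmalm_affine (ψ := 0) hzero (by simp) le_rfl (le_max_right C₀ 1), by
      simpa using hRφ⟩
  refine ⟨B₀ 0, hRmem, fun {A} hA => ?_⟩
  obtain ⟨hAc, φ, hφ, hAφ⟩ := id hA
  obtain ⟨-, ψ, c, hψ, hc, h0, h1⟩ := id hφ
  have hre : ∀ s ∈ halfPlane 0, 0 ≤ (ψ s).re := fun s hs => by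
    rcases Nat.eq_zero_or_pos c₀ with h | h
    · have : 1 / 2 < (ψ s).re := h0 h hs
      linarith
    · rcases h1 h with ⟨h2, h3⟩ | h2
      · rwa [h3 s hs]
      · exact le_of_lt (h2 hs)
  obtain ⟨C, hC⟩ := exists_continuousOn_isCompositionOperator c₀
    (HasUniformDirichletSeries.summable_shift hc)
  -- Large enough for d = 3c₀ + K to exceed both the threshold C for the r-path and the base point's
  -- constant; 3c₀ comes from c₀(s + 3).
  set K : ℝ≥0 := (max C (max C₀ 1)).toNNReal
  have hK : (K : ℝ) = max C (max C₀ 1) :=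
    Real.coe_toNNReal _ (zero_le_one.trans ((le_max_right _ _).trans (le_max_right _ _)))
  have hc0 : (0 : ℝ) ≤ 3 * c₀ := by positivity
  have hCd : C ≤ 3 * c₀ + K := by
    rw [hK]
    linarith [le_max_left C (max C₀ 1)]
  have hd : max C₀ 1 ≤ 3 * c₀ + (K : ℝ) := by
    rw [hK]
    linarith [le_max_right C (max C₀ 1)]
  obtain ⟨B, hBc, hB⟩ := hC _ hCd
  have hBφ : ∀ r ∈ Icc (0 : ℝ) 1, IsCompositionOperator
      (fun s => c₀ * s + (r * ψ (s + 3) + (3 * c₀ + K : ℝ))) (B r) := fun r hr f s hs => by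
    have hs' : 1 / 2 < s.re := hs
    rw [(hB r hr).2 f s hs]
    simp only [HasUniformDirichletSeries.apply_shift hc (show 0 < s.re by linarith)]
  have hBmem : ∀ r ∈ Icc (0 : ℝ) 1, B r ∈ compactCompositionOperators c₀ := fun r hr =>
    ⟨(hB r hr).1, _, isGordonHedenmalm_affine hc hre hr.1 ((le_max_right _ _).trans hd), hBφ r hr⟩
  have hjB : JoinedIn (compactCompositionOperators c₀) (B 0) (B 1) :=
    JoinedIn.ofLine hBc rfl rfl (by
      rintro _ ⟨r, hr, rfl⟩
      exact hBmem r hr)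
  have hB1 : ((translation 3).comp A).comp (translation K) = B 1 := by
    refine IsCompositionOperator.unique (fun f s hs => ?_) (hBφ 1 (by simp))
    have hs3 : s + ((3 : ℝ≥0) : ℝ) ∈ halfPlane (1 / 2) := by
      have : 1 / 2 < s.re := hs
      simp [halfPlane] at this ⊢
      linarith
    rw [ContinuousLinearMap.comp_apply, ContinuousLinearMap.comp_apply, eval_translation,
      hAφ _ _ hs3, eval_translation, hψ _ hs3]
    congr 1
    push_cast
    ring
  -- At r = 0 the trace of ψ is gone, and only the additive constant differs from the base point.
  have hB0 : (B₀ 0).comp (translation (3 * c₀ + K - max C₀ 1).toNNReal) = B 0 := by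
    refine IsCompositionOperator.unique (fun f s hs => ?_) (hBφ 0 (by simp))
    rw [ContinuousLinearMap.comp_apply, hRφ _ s hs, eval_translation,
      Real.coe_toNNReal _ (sub_nonneg.2 hd)]
    congr 1
    push_cast
    ring
  refine (hB0 ▸ joinedIn_comp_translation hRmem _).trans (hjB.trans (hB1 ▸ ?_))
  exact ((joinedIn_translation_comp hA 3).trans
    (joinedIn_comp_translation (translation_comp_mem hA 3) K)).symm
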